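/- Fix $k\in(0,1)$ and let $k'=\sqrt{1-k^2}$, $F(\varphi,k)=\int_0^{\varphi}\frac{d\theta}{\sqrt{1-k^2\sin^2\theta}}$, $K=K(k)=F(\tfrac{\pi}{2},k)$, $K'=K'(k)=K(k')$. There is a unique meromorphic function $\mathrm{cn}(\cdot,k)$ on $\mathbb{C}$ with $\mathrm{cn}(F(\varphi,k),k)=\cos\varphi$ for all $\varphi\in\mathbb{R}$ (the Jacobi elliptic function). Put $\lambda_1=-k^2$, $\lambda_2=1-2k^2$, $\lambda_3=1-k^2$ (so $\lambda_1<\lambda_2<\lambda_3$), and let $\Gamma=[0,K]\cup[K,K+iK']\cup[K+iK',2K+iK')\subset\mathbb{C}$, a union of three segments. For every real $\lambda\le\lambda_3$ the characteristic equation $$\lambda=1-2k^2+k^2\,\mathrm{cn}^2(\alpha,k)$$ has exactly one solution $\alpha\in\Gamma$, and it is given as follows. 1. If $\lambda\in[\lambda_2,\lambda_3]$, then $\alpha=F(\varphi_\alpha,k)\in[0,K]$, where $\varphi_\alpha\in[0,\frac{\pi}{2}]$ is determined by $$\sin\varphi_\alpha=\frac{\sqrt{1-k^2-\lambda}}{k}.$$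 2. If $\lambda\in[\lambda_1,\lambda_2]$, then $\alpha=K+i\beta$ with $\beta=F(\varphi_\beta,k')\in[0,K']$, where $\varphi_\beta\in[0,\frac{\pi}{2}]$ is determined by $$\sin\varphi_\beta=\frac{\sqrt{1-2k^2-\lambda}}{\sqrt{(1-k^2)(1-k^2-\lambda)}}.$$ 3. If $\lambda\in(-\infty,\lambda_1]$, then $\alpha=K+iK'+\gamma$ with $\gamma=F(\varphi_\gamma,k)\in[0,K)$, where $\varphi_\gamma\in[0,\frac{\pi}{2})$ is determined by $$\sin\varphi_\gamma=\frac{\sqrt{-k^2-\lambda}}{\sqrt{1-2k^2-\lambda}}.$$ Moreover, as $\lambda$ decreases, $\alpha$ strictly increases from $0$ (at $\lambda_3$) to $K$ (at $\lambda_2$) in case 1, $\beta$ strictly increases from $0$ (at $\lambda_2$) to $K'$ (at $\lambda_1$) in case 2, and $\gamma$ strictly increases from $0$ (at $\lambda_1$) and tends to $K$ as $\lambda\to-\infty$ in case 3. -/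

import Mathlib

noncomputable section

/-- Incomplete elliptic integral of the first kind, `F(φ, k) = ∫₀^φ dθ / √(1 - k² sin² θ)`. -/
def ellipticF (φ k : ℝ) : ℝ :=
  ∫ θ in (0 : ℝ)..φ, 1 / Real.sqrt (1 - k ^ 2 * Real.sin θ ^ 2)

/-- Complete elliptic integral of the first kind, `K(k) = F(π/2, k)`. -/
def ellipticK (k : ℝ) : ℝ := ellipticF (Real.pi / 2) k

/-- The complementary modulus `k' = √(1 - k²)`. -/
def compModulus (k : ℝ) : ℝ := Real.sqrt (1 - k ^ 2)

/-- `K'(k) = K(k')`. -/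
def ellipticK' (k : ℝ) : ℝ := ellipticK (compModulus k)

/-- `f` is the Jacobi elliptic function `cn(·, k)` of a complex argument: it is meromorphic on `ℂ`,
and on the real line `f x = cos φ` where `x = F(φ, k)`.  Normal form means that `f` takes its
analytic value at every point that is not a pole (and, by convention, the value `0` at poles), so
that `f` is pinned down at every point. -/
def IsJacobiCn (k : ℝ) (f : ℂ → ℂ) : Prop :=
  MeromorphicNFOn f Set.univ ∧
    ∀ φ : ℝ, f ((ellipticF φ k : ℝ) : ℂ) = ((Real.cos φ : ℝ) : ℂ)

/-- The Jacobi elliptic function `cn(z, k)`, for complex `z` and real modulus `k ∈ (0, 1)`. -/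
def jacobiCn (k : ℝ) : ℂ → ℂ := Classical.epsilon (IsJacobiCn k)

/-- The band edges of the Lamé equation. -/
def lam1 (k : ℝ) : ℝ := -k ^ 2

def lam2 (k : ℝ) : ℝ := 1 - 2 * k ^ 2

def lam3 (k : ℝ) : ℝ := 1 - k ^ 2

/-- The characteristic equation `l = 1 - 2k² + k² cn²(a, k)`. -/
def CharEq (k l : ℝ) (a : ℂ) : Prop :=
  (l : ℂ) = 1 - 2 * (k : ℂ) ^ 2 + (k : ℂ) ^ 2 * jacobiCn k a ^ 2

/-- The path `[0, K] ∪ [K, K + iK'] ∪ [K + iK', 2K + iK')` in the complex plane. -/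
def alphaPath (k : ℝ) : Set ℂ :=
  {a | (∃ x ∈ Set.Icc 0 (ellipticK k), a = (x : ℂ)) ∨
    (∃ β ∈ Set.Icc 0 (ellipticK' k), a = (ellipticK k : ℂ) + Complex.I * (β : ℂ)) ∨
    (∃ γ ∈ Set.Ico 0 (ellipticK k),
      a = (ellipticK k : ℂ) + Complex.I * (ellipticK' k : ℂ) + (γ : ℂ))}

end

/-! ### The elliptic integral on the real line -/

/-! Inverting $F(\cdot,k)$ gives the amplitude, hence real sn, cn, dn and their derivatives. The
complex cn is then written down explicitly: the addition formula and Jacobi's imaginary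
transformation express $\mathrm{cn}(x+iy,k)$ through real functions of moduli $k$ and $k'$. Where
the denominator is nonzero, the Cauchy-Riemann equations hold (`differentiableAt_complexCn`). Where
it vanishes, $\mathrm{cn}(-iz,k')=1/\mathrm{cn}(z,k)$ makes the reciprocal analytic
(`meromorphicNFOn_complexCn`). The identity theorem gives uniqueness, so `jacobiCn` is this explicit
function.

On the three segments $\mathrm{cn}^2$ is real: it equals $\cos^2\varphi$,
$-k'^2\sin^2\psi/(1-k'^2\sin^2\psi)$ and $-k'^2/(k^2\cos^2\varphi)$ in terms of the amplitude.
Solving the characteristic equation for $\sin^2$ of the amplitude gives the stated formulas, and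
$\sin^2$ is injective on $[0,\pi/2]$. The values of $\lambda$ attained lie in
$[\lambda_2,\lambda_3]$, $[\lambda_1,\lambda_2]$ and $(-\infty,\lambda_1]$, which overlap only at
band edges, where the two descriptions give the common endpoint of adjacent segments
(`charEq_cases`, `solution_lam2`, `solution_lam1`). -/

lemma one_sub_sq_mul_sin_sq_pos {k : ℝ} (hk : k ^ 2 < 1) (θ : ℝ) :
    0 < 1 - k ^ 2 * Real.sin θ ^ 2 := by
  nlinarith [Real.sin_sq_le_one θ, sq_nonneg k, sq_nonneg (Real.sin θ)]

lemma hasDerivAt_ellipticF {k : ℝ} (hk : k ^ 2 < 1) (φ : ℝ) :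
    HasDerivAt (fun φ => ellipticF φ k) (1 / Real.sqrt (1 - k ^ 2 * Real.sin φ ^ 2)) φ := by
  have hc : Continuous fun θ : ℝ => 1 / Real.sqrt (1 - k ^ 2 * Real.sin θ ^ 2) :=
    continuous_const.div (by fun_prop)
      fun θ => (Real.sqrt_pos.2 (one_sub_sq_mul_sin_sq_pos hk θ)).ne'
  exact intervalIntegral.integral_hasDerivAt_right (hc.intervalIntegrable _ _)
    (hc.stronglyMeasurableAtFilter _ _) hc.continuousAt

@[simp] lemma ellipticF_zero (k : ℝ) : ellipticF 0 k = 0 := by simp [ellipticF]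

lemma ellipticF_neg (φ k : ℝ) : ellipticF (-φ) k = -ellipticF φ k := by
  have h := intervalIntegral.integral_comp_neg (a := 0) (b := φ)
    (fun θ => 1 / Real.sqrt (1 - k ^ 2 * Real.sin θ ^ 2))
  simp only [Real.sin_neg, neg_sq, neg_zero] at h
  rw [ellipticF, ellipticF, h, intervalIntegral.integral_symm]

lemma continuous_ellipticF {k : ℝ} (hk : k ^ 2 < 1) : Continuous fun φ => ellipticF φ k :=
  continuous_iff_continuousAt.2 fun φ => (hasDerivAt_ellipticF hk φ).continuousAt

lemma strictMono_ellipticF {k : ℝ} (hk : k ^ 2 < 1) : StrictMono fun φ => ellipticF φ k :=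
  strictMono_of_hasDerivAt_pos (hasDerivAt_ellipticF hk) fun φ =>
    one_div_pos.2 (Real.sqrt_pos.2 (one_sub_sq_mul_sin_sq_pos hk φ))

/-- The integrand is at least 1. Hence $F$ dominates the identity at $+\infty$ and is dominated by
it at $-\infty$, which yields surjectivity. -/
lemma monotone_ellipticF_sub_id {k : ℝ} (hk : k ^ 2 < 1) :
    Monotone fun φ => ellipticF φ k - φ := by
  refine monotone_of_hasDerivAt_nonneg
    (fun φ => (hasDerivAt_ellipticF hk φ).sub (hasDerivAt_id φ)) fun φ => ?_
  have h0 := Real.sqrt_pos.2 (one_sub_sq_mul_sin_sq_pos hk φ)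
  have h1 : Real.sqrt (1 - k ^ 2 * Real.sin φ ^ 2) ≤ 1 :=
    Real.sqrt_le_one.2 (by nlinarith [mul_nonneg (sq_nonneg k) (sq_nonneg (Real.sin φ))])
  simpa using one_le_inv₀ h0 |>.2 h1

lemma surjective_ellipticF {k : ℝ} (hk : k ^ 2 < 1) :
    Function.Surjective fun φ => ellipticF φ k := by
  have hm := monotone_ellipticF_sub_id hk
  refine (continuous_ellipticF hk).surjective
    (Filter.tendsto_atTop_mono' _ ?_ Filter.tendsto_id)
    (Filter.tendsto_atBot_mono' _ ?_ Filter.tendsto_id)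
  · filter_upwards [Filter.eventually_ge_atTop 0] with φ hφ
    simpa using hm hφ
  · filter_upwards [Filter.eventually_le_atBot 0] with φ hφ
    simpa using hm hφ

/-! ### The amplitude and the Jacobi functions of a real argument -/

/-- The Jacobi amplitude, the inverse function of `ellipticF · k`. -/
noncomputable def jacobiAm (k : ℝ) : ℝ → ℝ := Function.invFun fun φ => ellipticF φ k

lemma jacobiAm_ellipticF {k : ℝ} (hk : k ^ 2 < 1) (φ : ℝ) : jacobiAm k (ellipticF φ k) = φ :=
  Function.leftInverse_invFun (strictMono_ellipticF hk).injective φ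

lemma ellipticF_jacobiAm {k : ℝ} (hk : k ^ 2 < 1) (u : ℝ) : ellipticF (jacobiAm k u) k = u :=
  Function.rightInverse_invFun (surjective_ellipticF hk) u

/-- The inverse of an increasing bijection is an order isomorphism, hence continuous;
differentiating the inverse function requires this first. -/
lemma continuous_jacobiAm {k : ℝ} (hk : k ^ 2 < 1) : Continuous (jacobiAm k) := by
  have h : jacobiAm k = ((strictMono_ellipticF hk).orderIsoOfSurjective _
      (surjective_ellipticF hk)).symm := by
    funext u
    refine (strictMono_ellipticF hk).injective ?_
    rw [ellipticF_jacobiAm hk]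
    exact (((strictMono_ellipticF hk).orderIsoOfSurjective _
      (surjective_ellipticF hk)).apply_symm_apply u).symm
  rw [h]
  exact OrderIso.continuous _

/-- The real delta amplitude `dn(u, k)`. -/
noncomputable def realDn (k u : ℝ) : ℝ := Real.sqrt (1 - k ^ 2 * Real.sin (jacobiAm k u) ^ 2)

/-- The real sine amplitude `sn(u, k)`. -/
noncomputable def realSn (k u : ℝ) : ℝ := Real.sin (jacobiAm k u)

/-- The real cosine amplitude `cn(u, k)`. -/
noncomputable def realCn (k u : ℝ) : ℝ := Real.cos (jacobiAm k u)

lemma realSn_sq_add_realCn_sq (k u : ℝ) : realSn k u ^ 2 + realCn k u ^ 2 = 1 :=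
  Real.sin_sq_add_cos_sq _

lemma realDn_pos {k : ℝ} (hk : k ^ 2 < 1) (u : ℝ) : 0 < realDn k u :=
  Real.sqrt_pos.2 (one_sub_sq_mul_sin_sq_pos hk _)

lemma realDn_sq {k : ℝ} (hk : k ^ 2 < 1) (u : ℝ) : realDn k u ^ 2 = 1 - k ^ 2 * realSn k u ^ 2 :=
  Real.sq_sqrt (one_sub_sq_mul_sin_sq_pos hk _).le

lemma hasDerivAt_jacobiAm {k : ℝ} (hk : k ^ 2 < 1) (u : ℝ) :
    HasDerivAt (jacobiAm k) (realDn k u) u := by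
  have h := HasDerivAt.of_local_left_inverse (continuous_jacobiAm hk).continuousAt
    (hasDerivAt_ellipticF hk (jacobiAm k u))
    (one_div_pos.2 (Real.sqrt_pos.2 (one_sub_sq_mul_sin_sq_pos hk _))).ne'
    (Filter.Eventually.of_forall (ellipticF_jacobiAm hk))
  simpa [realDn] using h

lemma hasDerivAt_realSn {k : ℝ} (hk : k ^ 2 < 1) (u : ℝ) :
    HasDerivAt (realSn k) (realCn k u * realDn k u) u :=
  (Real.hasDerivAt_sin _).comp u (hasDerivAt_jacobiAm hk u)

lemma hasDerivAt_realCn {k : ℝ} (hk : k ^ 2 < 1) (u : ℝ) :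
    HasDerivAt (realCn k) (-(realSn k u * realDn k u)) u :=
  ((Real.hasDerivAt_cos _).comp u (hasDerivAt_jacobiAm hk u)).congr_deriv (neg_mul _ _)

lemma hasDerivAt_realDn {k : ℝ} (hk : k ^ 2 < 1) (u : ℝ) :
    HasDerivAt (realDn k) (-(k ^ 2 * realSn k u * realCn k u)) u := by
  have h : HasDerivAt (fun v => 1 - k ^ 2 * realSn k v ^ 2)
      (-(k ^ 2 * (2 * realSn k u * (realCn k u * realDn k u)))) u := by
    simpa using (((hasDerivAt_realSn hk u).pow 2).const_mul (k ^ 2)).const_sub 1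
  have hd := (realDn_pos hk u).ne'
  refine (h.sqrt (one_sub_sq_mul_sin_sq_pos hk _).ne').congr_deriv ?_
  change _ / (2 * realDn k u) = _
  field_simp

lemma jacobiAm_neg {k : ℝ} (hk : k ^ 2 < 1) (u : ℝ) : jacobiAm k (-u) = -jacobiAm k u := by
  refine (strictMono_ellipticF hk).injective ?_
  rw [ellipticF_neg, ellipticF_jacobiAm hk, ellipticF_jacobiAm hk]

lemma realSn_neg {k : ℝ} (hk : k ^ 2 < 1) (u : ℝ) : realSn k (-u) = -realSn k u := by
  simp [realSn, jacobiAm_neg hk]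

lemma realCn_neg {k : ℝ} (hk : k ^ 2 < 1) (u : ℝ) : realCn k (-u) = realCn k u := by
  simp [realCn, jacobiAm_neg hk]

lemma realDn_neg {k : ℝ} (hk : k ^ 2 < 1) (u : ℝ) : realDn k (-u) = realDn k u := by
  simp [realDn, jacobiAm_neg hk]

lemma realSn_ellipticF {k : ℝ} (hk : k ^ 2 < 1) (φ : ℝ) :
    realSn k (ellipticF φ k) = Real.sin φ := by rw [realSn, jacobiAm_ellipticF hk]

lemma realCn_ellipticF {k : ℝ} (hk : k ^ 2 < 1) (φ : ℝ) :
    realCn k (ellipticF φ k) = Real.cos φ := by rw [realCn, jacobiAm_ellipticF hk]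

lemma compModulus_sq {k : ℝ} (hk : k ^ 2 < 1) : compModulus k ^ 2 = 1 - k ^ 2 :=
  Real.sq_sqrt (by linarith)

/-- The quarter-period shift `K + F(φ, k) = F(π/2 + arctan (k' tan φ), k)`. -/
lemma ellipticF_quarter_shift {k : ℝ} (hk : k ^ 2 < 1) {φ : ℝ}
    (h0 : 0 ≤ φ) (h1 : φ < Real.pi / 2) :
    ellipticF (Real.pi / 2 + Real.arctan (compModulus k * Real.tan φ)) k =
      ellipticK k + ellipticF φ k := by
  have hk' : 0 < compModulus k := Real.sqrt_pos.2 (by linarith)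
  have hk2 := compModulus_sq hk
  -- The difference of the two integrals has zero derivative and equals $K$ at $\varphi=0$. The
  -- restriction $\varphi<\pi/2$ keeps $\tan$ smooth on the interval.
  have hder : ∀ x ∈ Set.Icc 0 φ, HasDerivAt (fun φ =>
      ellipticF (Real.pi / 2 + Real.arctan (compModulus k * Real.tan φ)) k - ellipticF φ k)
      0 x := by
    intro x hx
    have hc : 0 < Real.cos x :=
      Real.cos_pos_of_mem_Ioo ⟨by linarith [hx.1, Real.pi_pos], by linarith [hx.2]⟩
    have hin : HasDerivAt (fun φ => Real.pi / 2 + Real.arctan (compModulus k * Real.tan φ))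
        (1 / (1 + (compModulus k * Real.tan x) ^ 2) * (compModulus k * (1 / Real.cos x ^ 2))) x :=
      (((Real.hasDerivAt_tan hc.ne').const_mul _).arctan).const_add _
    refine (((hasDerivAt_ellipticF hk _).comp x hin).sub
      (hasDerivAt_ellipticF hk x)).congr_deriv ?_
    have hs := one_sub_sq_mul_sin_sq_pos hk x
    have hpos : 0 < Real.cos x ^ 2 + compModulus k ^ 2 * Real.sin x ^ 2 := by positivity
    have hΔ : Real.cos x ^ 2 + compModulus k ^ 2 * Real.sin x ^ 2 = 1 - k ^ 2 * Real.sin x ^ 2 := by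
      rw [hk2, Real.cos_sq']; ring
    -- With $\Delta=\sqrt{1-k^2\sin^2 x}$, the shift turns $\Delta$ into $k'/\Delta$; this factor
    -- cancels the derivative of the inner arctangent.
    have hsin : 1 - k ^ 2 * Real.sin (Real.pi / 2 +
        Real.arctan (compModulus k * Real.tan x)) ^ 2 =
        compModulus k ^ 2 / (1 - k ^ 2 * Real.sin x ^ 2) := by
      rw [add_comm (Real.pi / 2), Real.sin_add_pi_div_two, Real.cos_sq_arctan,
        Real.tan_eq_sin_div_cos, ← hΔ]
      have hne : 1 + (compModulus k * (Real.sin x / Real.cos x)) ^ 2 ≠ 0 := by positivity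
      field_simp
      rw [hk2, Real.cos_sq' x]; ring
    rw [hsin, Real.sqrt_div (sq_nonneg _), Real.sqrt_sq hk'.le, Real.tan_eq_sin_div_cos]
    have hsq := Real.sq_sqrt hs.le
    have hsp := Real.sqrt_pos.2 hs
    have he : 1 + (compModulus k * (Real.sin x / Real.cos x)) ^ 2 =
        Real.sqrt (1 - k ^ 2 * Real.sin x ^ 2) ^ 2 / Real.cos x ^ 2 := by
      rw [hsq, ← hΔ]; field_simp
    rw [he]
    field_simp
    ring
  have hconst := constant_of_has_deriv_right_zero
    (fun x hx => (hder x hx).continuousAt.continuousWithinAt)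
    (fun x hx => (hder x ⟨hx.1, hx.2.le⟩).hasDerivWithinAt) φ ⟨h0, le_rfl⟩
  simp only [Real.tan_zero, mul_zero, Real.arctan_zero, add_zero, ellipticF_zero] at hconst
  rw [ellipticK]
  linarith

/-! ### The Jacobi function `cn` of a complex argument -/

/-- A real-differentiable function satisfying the Cauchy-Riemann equations, in terms of its
restrictions to the horizontal and vertical lines, is complex differentiable. -/
lemma differentiableAt_complex_of_hasDerivAt_lines {f : ℂ → ℂ} {z a : ℂ}
    (hf : DifferentiableAt ℝ f z)
    (hx : HasDerivAt (fun t : ℝ => f (t + z.im * Complex.I)) a z.re)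
    (hy : HasDerivAt (fun t : ℝ => f (z.re + t * Complex.I)) (Complex.I * a) z.im) :
    DifferentiableAt ℂ f z := by
  refine differentiableAt_complex_iff_differentiableAt_real.2 ⟨hf, ?_⟩
  have hz : (z.re : ℂ) + z.im * Complex.I = z := Complex.re_add_im z
  have lx : HasDerivAt (fun t : ℝ => (t : ℂ) + z.im * Complex.I) 1 z.re :=
    Complex.ofRealCLM.hasDerivAt.add_const _
  have ly : HasDerivAt (fun t : ℝ => (z.re : ℂ) + t * Complex.I) Complex.I z.im := by
    simpa using! (Complex.ofRealCLM.hasDerivAt.mul_const Complex.I).const_add (z.re : ℂ)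
  have e1 := HasFDerivAt.comp_hasDerivAt_of_eq z.re hf.hasFDerivAt lx hz.symm
  have e2 := HasFDerivAt.comp_hasDerivAt_of_eq z.im hf.hasFDerivAt ly hz.symm
  rw [e1.unique hx, e2.unique hy, smul_eq_mul]

/-- The denominator of `cn(x + iy, k)` in the addition formula. -/
noncomputable def cnDen (k x y : ℝ) : ℝ :=
  realCn (compModulus k) y ^ 2 + k ^ 2 * realSn k x ^ 2 * realSn (compModulus k) y ^ 2

/-- The real part of the numerator of `cn(x + iy, k)` in the addition formula. -/
noncomputable def cnNumRe (k x y : ℝ) : ℝ := realCn k x * realCn (compModulus k) y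

/-- Minus the imaginary part of the numerator of `cn(x + iy, k)` in the addition formula. -/
noncomputable def cnNumIm (k x y : ℝ) : ℝ :=
  realSn k x * realDn k x * (realSn (compModulus k) y * realDn (compModulus k) y)

/-- The function `cn(x + iy, k)`, written by means of the addition formula and Jacobi's imaginary
transformation in terms of the real Jacobi functions of moduli `k` and `k'`. -/
noncomputable def complexCn (k : ℝ) (z : ℂ) : ℂ :=
  ((cnNumRe k z.re z.im : ℂ) - Complex.I * (cnNumIm k z.re z.im : ℂ)) / (cnDen k z.re z.im : ℂ)

lemma compModulus_sq_lt_one {k : ℝ} (hk : k ∈ Set.Ioo (0 : ℝ) 1) : compModulus k ^ 2 < 1 := by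
  have h : k ^ 2 < 1 := by nlinarith [hk.1, hk.2]
  rw [compModulus_sq h]
  nlinarith [hk.1]

lemma compModulus_mem_Ioo {k : ℝ} (hk : k ∈ Set.Ioo (0 : ℝ) 1) :
    compModulus k ∈ Set.Ioo (0 : ℝ) 1 :=
  ⟨Real.sqrt_pos.2 (by nlinarith [hk.1, hk.2]),
    (abs_lt.1 ((sq_lt_one_iff_abs_lt_one _).1 (compModulus_sq_lt_one hk))).2⟩

lemma compModulus_compModulus {k : ℝ} (hk : k ∈ Set.Ioo (0 : ℝ) 1) :
    compModulus (compModulus k) = k := by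
  have h : k ^ 2 < 1 := by nlinarith [hk.1, hk.2]
  rw [compModulus, compModulus_sq h, sub_sub_cancel, Real.sqrt_sq hk.1.le]

lemma sq_lt_one_of_mem_Ioo {k : ℝ} (hk : k ∈ Set.Ioo (0 : ℝ) 1) : k ^ 2 < 1 := by nlinarith [hk.1, hk.2]

lemma differentiableAt_complexCn {k : ℝ} (hk : k ∈ Set.Ioo (0 : ℝ) 1) {z : ℂ}
    (hz : cnDen k z.re z.im ≠ 0) :
    DifferentiableAt ℂ (complexCn k) z := by
  have h1 := sq_lt_one_of_mem_Ioo hk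
  have h2 := compModulus_sq_lt_one hk
  have hkk := compModulus_sq h1
  set s := realSn k z.re
  set c := realCn k z.re
  set d := realDn k z.re
  set s' := realSn (compModulus k) z.im
  set c' := realCn (compModulus k) z.im
  set d' := realDn (compModulus k) z.im
  have hs := hasDerivAt_realSn h1 z.re
  have hc := hasDerivAt_realCn h1 z.re
  have hd := hasDerivAt_realDn h1 z.re
  have hs' := hasDerivAt_realSn h2 z.im
  have hc' := hasDerivAt_realCn h2 z.im
  have hd' := hasDerivAt_realDn h2 z.im
  have es := realSn_sq_add_realCn_sq k z.re
  have es' := realSn_sq_add_realCn_sq (compModulus k) z.im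
  have ed := realDn_sq h1 z.re
  have ed' := realDn_sq h2 z.im
  rw [hkk] at ed' hd'
  have hzC : (cnDen k z.re z.im : ℂ) ≠ 0 := Complex.ofReal_ne_zero.2 hz
  have hre : HasDerivAt (fun t => cnNumRe k t z.im) (-(s * d) * c') z.re := hc.mul_const _
  have him : HasDerivAt (fun t => cnNumIm k t z.im)
      ((c * d * d + s * -(k ^ 2 * s * c)) * (s' * d')) z.re := (hs.mul hd).mul_const _
  have hde : HasDerivAt (fun t => cnDen k t z.im) (k ^ 2 * (2 * s * (c * d)) * s' ^ 2) z.re := by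
    refine HasDerivAt.const_add (c' ^ 2) (HasDerivAt.mul_const (HasDerivAt.const_mul (k ^ 2) ?_) _)
    simpa using! hs.pow 2
  have hre' : HasDerivAt (fun t => cnNumRe k z.re t) (c * -(s' * d')) z.im := hc'.const_mul _
  have him' : HasDerivAt (fun t => cnNumIm k z.re t)
      (s * d * (c' * d' * d' + s' * -((1 - k ^ 2) * s' * c'))) z.im := (hs'.mul hd').const_mul _
  have hde' : HasDerivAt (fun t => cnDen k z.re t)
      (2 * c' * -(s' * d') + k ^ 2 * s ^ 2 * (2 * s' * (c' * d'))) z.im := by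
    simpa using! (hc'.pow 2).add ((hs'.pow 2).const_mul (k ^ 2 * s ^ 2))
  have hc2 : c' ^ 2 = 1 - s' ^ 2 := by linarith
  have hDen : cnDen k z.re z.im = 1 - s' ^ 2 + k ^ 2 * s ^ 2 * s' ^ 2 := by
    rw [cnDen]; change c' ^ 2 + _ = _; rw [hc2]
  -- Write cn as $u+iv$. Cleared of the squared denominator, `cr1` is $u_y=-v_x$ and `cr2` is
  -- $v_y=u_x$.
  have cr1 : (c * -(s' * d')) * cnDen k z.re z.im -
      cnNumRe k z.re z.im * (2 * c' * -(s' * d') + k ^ 2 * s ^ 2 * (2 * s' * (c' * d'))) =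
      ((c * d * d + s * -(k ^ 2 * s * c)) * (s' * d')) * cnDen k z.re z.im -
      cnNumIm k z.re z.im * (k ^ 2 * (2 * s * (c * d)) * s' ^ 2) := by
    rw [hDen]
    change _ - c * c' * _ = _ - s * d * (s' * d') * _
    linear_combination 2 * c * s' * d' * (1 - k ^ 2 * s ^ 2) * hc2 -
      c * s' * d' * (1 - s' ^ 2 + k ^ 2 * s ^ 2 * s' ^ 2 - 2 * k ^ 2 * s ^ 2 * s' ^ 2) * ed
  have cr2 : -((s * d * (c' * d' * d' + s' * -((1 - k ^ 2) * s' * c'))) * cnDen k z.re z.im -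
      cnNumIm k z.re z.im * (2 * c' * -(s' * d') + k ^ 2 * s ^ 2 * (2 * s' * (c' * d')))) =
      (-(s * d) * c') * cnDen k z.re z.im -
      cnNumRe k z.re z.im * (k ^ 2 * (2 * s * (c * d)) * s' ^ 2) := by
    rw [hDen]
    change -(_ - s * d * (s' * d') * _) = _ - c * c' * _
    have hc1 : c ^ 2 = 1 - s ^ 2 := by linarith
    linear_combination (-s * d * c' * (1 - s' ^ 2 + k ^ 2 * s ^ 2 * s' ^ 2)
      - s * d * 2 * c' * s' ^ 2 * (1 - k ^ 2 * s ^ 2)) * ed' +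
      2 * k ^ 2 * s * d * c' * s' ^ 2 * hc1
  have hx := ((hre.ofReal_comp.sub (him.ofReal_comp.const_mul Complex.I)).div hde.ofReal_comp hzC)
  have hy := ((hre'.ofReal_comp.sub (him'.ofReal_comp.const_mul Complex.I)).div
    hde'.ofReal_comp hzC)
  refine differentiableAt_complex_of_hasDerivAt_lines ?_
    (hx.congr_of_eventuallyEq (.of_forall fun t => by simp [complexCn]))
    ((hy.congr_of_eventuallyEq (.of_forall fun t => by simp [complexCn])).congr_deriv ?_)
  -- Partial derivatives alone do not suffice, so joint real differentiability is obtained by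
  -- composition.
  · unfold complexCn
    have ds : DifferentiableAt ℝ (fun w : ℂ => realSn k w.re) z :=
      hs.differentiableAt.comp z Complex.reCLM.differentiableAt
    have dc : DifferentiableAt ℝ (fun w : ℂ => realCn k w.re) z :=
      hc.differentiableAt.comp z Complex.reCLM.differentiableAt
    have dd : DifferentiableAt ℝ (fun w : ℂ => realDn k w.re) z :=
      hd.differentiableAt.comp z Complex.reCLM.differentiableAt
    have ds' : DifferentiableAt ℝ (fun w : ℂ => realSn (compModulus k) w.im) z :=
      hs'.differentiableAt.comp z Complex.imCLM.differentiableAt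
    have dc' : DifferentiableAt ℝ (fun w : ℂ => realCn (compModulus k) w.im) z :=
      hc'.differentiableAt.comp z Complex.imCLM.differentiableAt
    have dd' : DifferentiableAt ℝ (fun w : ℂ => realDn (compModulus k) w.im) z :=
      hd'.differentiableAt.comp z Complex.imCLM.differentiableAt
    have cast : ∀ {g : ℂ → ℝ}, DifferentiableAt ℝ g z →
        DifferentiableAt ℝ (fun w => (g w : ℂ)) z :=
      fun hg => Complex.ofRealCLM.differentiableAt.comp z hg
    have dN : DifferentiableAt ℝ (fun w : ℂ => cnNumRe k w.re w.im) z := dc.mul dc'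
    have dM : DifferentiableAt ℝ (fun w : ℂ => cnNumIm k w.re w.im) z :=
      (ds.mul dd).mul (ds'.mul dd')
    have dD : DifferentiableAt ℝ (fun w : ℂ => cnDen k w.re w.im) z :=
      (dc'.pow 2).add (((ds.pow 2).const_mul (k ^ 2)).mul (ds'.pow 2))
    simp only [div_eq_mul_inv]
    exact ((cast dN).sub ((cast dM).const_mul Complex.I)).mul ((cast dD).inv hzC)
  · rw [← mul_div_assoc]
    congr 1
    have cr1C := congrArg (fun r : ℝ => (r : ℂ)) cr1
    have cr2C := congrArg (fun r : ℝ => (r : ℂ)) cr2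
    push_cast at cr1C cr2C ⊢
    simp only [Pi.sub_apply]
    linear_combination cr1C + Complex.I * cr2C +
      ((c * d * d + s * -((k : ℂ) ^ 2 * s * c)) * (s' * d') * cnDen k z.re z.im -
      cnNumIm k z.re z.im * ((k : ℂ) ^ 2 * (2 * s * (c * d)) * s' ^ 2)) * Complex.I_sq

lemma analyticAt_complexCn {k : ℝ} (hk : k ∈ Set.Ioo (0 : ℝ) 1) {z : ℂ}
    (hz : cnDen k z.re z.im ≠ 0) :
    AnalyticAt ℂ (complexCn k) z := by
  have h1 := sq_lt_one_of_mem_Ioo hk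
  have h2 := compModulus_sq_lt_one hk
  have cs : Continuous (realSn k) :=
    continuous_iff_continuousAt.2 fun u => (hasDerivAt_realSn h1 u).continuousAt
  have cs' : Continuous (realSn (compModulus k)) :=
    continuous_iff_continuousAt.2 fun u => (hasDerivAt_realSn h2 u).continuousAt
  have cc' : Continuous (realCn (compModulus k)) :=
    continuous_iff_continuousAt.2 fun u => (hasDerivAt_realCn h2 u).continuousAt
  have hD : Continuous fun w : ℂ => cnDen k w.re w.im := by
    unfold cnDen
    fun_prop
  have ho : IsOpen {w : ℂ | cnDen k w.re w.im ≠ 0} := isOpen_ne_fun hD continuous_const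
  have hd : DifferentiableOn ℂ (complexCn k) {w : ℂ | cnDen k w.re w.im ≠ 0} :=
    fun w hw => (differentiableAt_complexCn hk hw).differentiableWithinAt
  exact hd.analyticAt (ho.mem_nhds hz)

lemma cnDen_compModulus {k : ℝ} (hk : k ∈ Set.Ioo (0 : ℝ) 1) (x y : ℝ) :
    cnDen (compModulus k) y (-x) =
      realCn k x ^ 2 + (1 - k ^ 2) * realSn (compModulus k) y ^ 2 * realSn k x ^ 2 := by
  have h1 := sq_lt_one_of_mem_Ioo hk
  rw [cnDen, compModulus_compModulus hk, realCn_neg h1, realSn_neg h1, neg_sq, compModulus_sq h1]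

/-- The squared modulus of the numerator factors into the denominators of $\mathrm{cn}(z,k)$ and
$\mathrm{cn}(-iz,k')$. This is the algebraic content of the imaginary transformation. -/
lemma cnNumRe_sq_add_cnNumIm_sq {k : ℝ} (hk : k ∈ Set.Ioo (0 : ℝ) 1) (x y : ℝ) :
    cnNumRe k x y ^ 2 + cnNumIm k x y ^ 2 = cnDen k x y * cnDen (compModulus k) y (-x) := by
  have h1 := sq_lt_one_of_mem_Ioo hk
  have h2 := compModulus_sq_lt_one hk
  rw [cnDen_compModulus hk]
  simp only [cnDen, cnNumRe, cnNumIm, mul_pow]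
  rw [realDn_sq h1, realDn_sq h2, compModulus_sq h1,
    eq_sub_iff_add_eq'.2 (realSn_sq_add_realCn_sq k x),
    eq_sub_iff_add_eq'.2 (realSn_sq_add_realCn_sq (compModulus k) y)]
  ring

/-- Jacobi's imaginary transformation `cn(-iz, k') = 1 / cn(z, k)`. -/
lemma complexCn_neg_I_mul_eq_inv {k : ℝ} (hk : k ∈ Set.Ioo (0 : ℝ) 1) (z : ℂ) :
    complexCn (compModulus k) (-(Complex.I * z)) = (complexCn k z)⁻¹ := by
  have h1 := sq_lt_one_of_mem_Ioo hk
  have hq := cnNumRe_sq_add_cnNumIm_sq hk z.re z.im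
  have hN : cnNumRe (compModulus k) z.im (-z.re) = cnNumRe k z.re z.im := by
    rw [cnNumRe, cnNumRe, compModulus_compModulus hk, realCn_neg h1, mul_comm]
  have hM : cnNumIm (compModulus k) z.im (-z.re) = -cnNumIm k z.re z.im := by
    rw [cnNumIm, cnNumIm, compModulus_compModulus hk, realSn_neg h1, realDn_neg h1]
    ring
  simp only [complexCn, Complex.neg_re, Complex.neg_im, Complex.I_mul_re, Complex.I_mul_im,
    neg_neg, hN, hM, inv_div]
  generalize cnNumRe k z.re z.im = n at *
  generalize cnNumIm k z.re z.im = m at *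
  generalize cnDen k z.re z.im = D at *
  generalize cnDen (compModulus k) z.im (-z.re) = E at *
  -- If the numerator vanishes, both sides are 0 by the convention for division by zero. This covers
  -- the poles and zeros of cn.
  by_cases h0 : n ^ 2 + m ^ 2 = 0
  · have hn : n = 0 := by nlinarith [sq_nonneg n, sq_nonneg m]
    have hm : m = 0 := by nlinarith [sq_nonneg n, sq_nonneg m]
    simp [hn, hm]
  · have hE : (E : ℂ) ≠ 0 := by
      rintro h
      exact h0 (by rw [hq, Complex.ofReal_eq_zero.1 h, mul_zero])
    have hprod : ((n : ℂ) - Complex.I * m) * (n + Complex.I * m) = D * E := by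
      have : ((n ^ 2 + m ^ 2 : ℝ) : ℂ) = ((D * E : ℝ) : ℂ) := by rw [hq]
      push_cast at this
      linear_combination this - (m : ℂ) ^ 2 * Complex.I_sq
    have hne : (n : ℂ) - Complex.I * m ≠ 0 := by
      intro h
      rw [h, zero_mul] at hprod
      exact h0 (by rw [hq]; exact_mod_cast hprod.symm)
    rw [div_eq_div_iff hE hne]
    push_cast
    linear_combination hprod

/-- A zero of the first denominator forces $\mathrm{cn}(y,k')=0$ and $\mathrm{sn}(x,k)=0$, and then
the second denominator equals $\mathrm{cn}^2(x,k)=1$. -/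
lemma cnDen_compModulus_ne_zero {k : ℝ} (hk : k ∈ Set.Ioo (0 : ℝ) 1) {x y : ℝ}
    (h : cnDen k x y = 0) : cnDen (compModulus k) y (-x) ≠ 0 := by
  have hk0 := hk.1
  have es := realSn_sq_add_realCn_sq k x
  have es' := realSn_sq_add_realCn_sq (compModulus k) y
  rw [cnDen_compModulus hk]
  unfold cnDen at h
  have hc : realCn (compModulus k) y ^ 2 = 0 := by
    refine le_antisymm ?_ (sq_nonneg _)
    rw [← h]
    exact le_add_of_nonneg_right (by positivity)
  have hs' : realSn (compModulus k) y ^ 2 = 1 := by linarith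
  rw [hc, hs', zero_add, mul_one] at h
  have hs : realSn k x ^ 2 = 0 := (mul_eq_zero.1 h).resolve_left (by positivity)
  rw [hs, mul_zero, add_zero]
  linarith

/-- At a zero of the denominator the reciprocal is analytic by the imaginary transformation, and
normal form is stable under inversion. -/
lemma meromorphicNFOn_complexCn {k : ℝ} (hk : k ∈ Set.Ioo (0 : ℝ) 1) : MeromorphicNFOn (complexCn k) Set.univ := by
  intro z _
  by_cases hz : cnDen k z.re z.im = 0
  · have h := analyticAt_complexCn (compModulus_mem_Ioo hk) (z := -(Complex.I * z))
      (by simpa using cnDen_compModulus_ne_zero hk hz)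
    have h' : AnalyticAt ℂ (fun w => complexCn (compModulus k) (-(Complex.I * w))) z :=
      h.comp (g := complexCn (compModulus k)) (f := fun w => -(Complex.I * w)) (by fun_prop)
    have he : (fun w => complexCn (compModulus k) (-(Complex.I * w))) = (complexCn k)⁻¹ :=
      funext (complexCn_neg_I_mul_eq_inv hk)
    rw [he] at h'
    exact meromorphicNFAt_inv.1 h'.meromorphicNFAt
  · exact (analyticAt_complexCn hk hz).meromorphicNFAt

lemma isJacobiCn_complexCn {k : ℝ} (hk : k ∈ Set.Ioo (0 : ℝ) 1) : IsJacobiCn k (complexCn k) := by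
  refine ⟨meromorphicNFOn_complexCn hk, fun φ => ?_⟩
  have h2 := compModulus_sq_lt_one hk
  have hs := realSn_ellipticF h2 0
  have hc := realCn_ellipticF h2 0
  simp only [ellipticF_zero, Real.sin_zero, Real.cos_zero] at hs hc
  simp [complexCn, cnNumRe, cnNumIm, cnDen, hs, hc,
    realCn_ellipticF (sq_lt_one_of_mem_Ioo hk)]

/-- Two meromorphic functions in normal form that agree on the real line are equal. -/
lemma eq_of_meromorphicNFOn_of_eq_on_real {f g : ℂ → ℂ} (hf : MeromorphicNFOn f Set.univ)
    (hg : MeromorphicNFOn g Set.univ) (h : ∀ x : ℝ, f x = g x) : f = g := by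
  have hsub : MeromorphicOn (f - g) Set.univ := hf.meromorphicOn.sub hg.meromorphicOn
  -- Zeros of $f-g$ accumulate at 0 along the real axis, so the order is infinite there;
  -- connectedness of the plane propagates this to every point.
  have h0 : meromorphicOrderAt (f - g) 0 = ⊤ := by
    rw [meromorphicOrderAt_eq_top_iff]
    refine (hsub 0 trivial).frequently_zero_iff_eventuallyEq_zero.1 ?_
    have ht : Filter.Tendsto (fun x : ℝ => (x : ℂ)) (nhdsWithin 0 {0}ᶜ) (nhdsWithin 0 {0}ᶜ) :=
      tendsto_nhdsWithin_iff.2 ⟨(Complex.continuous_ofReal.tendsto' 0 0 rfl).mono_left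
        nhdsWithin_le_nhds, eventually_nhdsWithin_of_forall fun x hx => by simpa using hx⟩
    exact ht.frequently (Filter.Frequently.of_forall fun x => by simp [h x])
  funext z
  have hz : meromorphicOrderAt (f - g) z = ⊤ := by
    by_contra hne
    exact hsub.meromorphicOrderAt_ne_top_of_isPreconnected isPreconnected_univ
      (Set.mem_univ z) (Set.mem_univ 0) hne h0
  rw [meromorphicOrderAt_eq_top_iff] at hz
  -- Infinite order gives agreement only on a punctured neighbourhood; normal form extends it to the
  -- point itself.
  refine (((hf (Set.mem_univ z)).eventuallyEq_nhdsNE_iff_eventuallyEq_nhds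
    (hg (Set.mem_univ z))).1 ?_).eq_of_nhds
  filter_upwards [hz] with w hw
  exact sub_eq_zero.1 hw

lemma existsUnique_isJacobiCn {k : ℝ} (hk : k ∈ Set.Ioo (0 : ℝ) 1) : ∃! f : ℂ → ℂ, IsJacobiCn k f := by
  refine ⟨complexCn k, isJacobiCn_complexCn hk, fun f hf => ?_⟩
  refine eq_of_meromorphicNFOn_of_eq_on_real hf.1 (meromorphicNFOn_complexCn hk) fun x => ?_
  obtain ⟨φ, rfl⟩ := surjective_ellipticF (sq_lt_one_of_mem_Ioo hk) x
  exact (hf.2 φ).trans ((isJacobiCn_complexCn hk).2 φ).symm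

lemma jacobiCn_eq_complexCn {k : ℝ} (hk : k ∈ Set.Ioo (0 : ℝ) 1) : jacobiCn k = complexCn k :=
  (existsUnique_isJacobiCn hk).unique
    (Classical.epsilon_spec ⟨_, isJacobiCn_complexCn hk⟩) (isJacobiCn_complexCn hk)

/-! ### The characteristic equation on the three segments of the path -/

lemma ellipticF_mem_Icc {k : ℝ} (hk : k ^ 2 < 1) {φ : ℝ}
    (h : φ ∈ Set.Icc 0 (Real.pi / 2)) : ellipticF φ k ∈ Set.Icc 0 (ellipticK k) :=
  ⟨by simpa using (strictMono_ellipticF hk).monotone h.1, (strictMono_ellipticF hk).monotone h.2⟩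

lemma ellipticF_mem_Ico {k : ℝ} (hk : k ^ 2 < 1) {φ : ℝ}
    (h : φ ∈ Set.Ico 0 (Real.pi / 2)) : ellipticF φ k ∈ Set.Ico 0 (ellipticK k) :=
  ⟨by simpa using (strictMono_ellipticF hk).monotone h.1, strictMono_ellipticF hk h.2⟩

lemma exists_ellipticF_eq_of_mem_Icc {k : ℝ} (hk : k ^ 2 < 1) {x : ℝ}
    (hx : x ∈ Set.Icc 0 (ellipticK k)) : ∃ φ ∈ Set.Icc 0 (Real.pi / 2), ellipticF φ k = x := by
  obtain ⟨φ, rfl⟩ := surjective_ellipticF hk x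
  refine ⟨φ, ⟨(strictMono_ellipticF hk).le_iff_le.1 ?_, (strictMono_ellipticF hk).le_iff_le.1 hx.2⟩,
    rfl⟩
  simpa using hx.1

lemma exists_ellipticF_eq_of_mem_Ico {k : ℝ} (hk : k ^ 2 < 1) {x : ℝ}
    (hx : x ∈ Set.Ico 0 (ellipticK k)) : ∃ φ ∈ Set.Ico 0 (Real.pi / 2), ellipticF φ k = x := by
  obtain ⟨φ, hφ, rfl⟩ := exists_ellipticF_eq_of_mem_Icc hk ⟨hx.1, hx.2.le⟩
  exact ⟨φ, ⟨hφ.1, (strictMono_ellipticF hk).lt_iff_lt.1 hx.2⟩, rfl⟩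

lemma charEq_iff_of_sq {k l r : ℝ} {a : ℂ} (h : jacobiCn k a ^ 2 = (r : ℂ)) :
    CharEq k l a ↔ l = 1 - 2 * k ^ 2 + k ^ 2 * r := by
  rw [CharEq, h]
  norm_cast

lemma charEq_ellipticF_iff {k : ℝ} (hk : k ∈ Set.Ioo (0 : ℝ) 1) (l φ : ℝ) :
    CharEq k l (ellipticF φ k : ℂ) ↔ Real.sin φ ^ 2 = (1 - k ^ 2 - l) / k ^ 2 := by
  have hk0 : k ≠ 0 := hk.1.ne'
  rw [charEq_iff_of_sq (r := Real.cos φ ^ 2), Real.cos_sq', eq_div_iff (pow_ne_zero 2 hk0)]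
  · constructor <;> intro h <;> linarith
  · rw [jacobiCn_eq_complexCn hk, (isJacobiCn_complexCn hk).2 φ]
    norm_cast

/-- At real part $K$ one has $\mathrm{cn}=0$, $\mathrm{sn}=1$, $\mathrm{dn}^2=k'^2$. The numerator
is then purely imaginary, so the square is real and nonpositive. -/
lemma complexCn_K_add_I_mul_sq {k : ℝ} (hk : k ∈ Set.Ioo (0 : ℝ) 1) (ψ : ℝ) :
    complexCn k ((ellipticK k : ℂ) + Complex.I * (ellipticF ψ (compModulus k) : ℂ)) ^ 2 =
      ((-((1 - k ^ 2) * Real.sin ψ ^ 2 / (1 - (1 - k ^ 2) * Real.sin ψ ^ 2)) : ℝ) : ℂ) := by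
  have h1 := sq_lt_one_of_mem_Ioo hk
  have h2 := compModulus_sq_lt_one hk
  have hpos := one_sub_sq_mul_sin_sq_pos h2 ψ
  have e1 : realSn k (ellipticK k) = 1 := by simp [ellipticK, realSn_ellipticF h1]
  have e2 : realCn k (ellipticK k) = 0 := by simp [ellipticK, realCn_ellipticF h1]
  have e3 := realDn_sq h1 (ellipticK k)
  have e4 := realDn_sq h2 (ellipticF ψ (compModulus k))
  have e5 := realSn_sq_add_realCn_sq (compModulus k) (ellipticF ψ (compModulus k))
  rw [realSn_ellipticF h2] at e4 e5
  rw [e1] at e3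
  rw [compModulus_sq h1] at e4 hpos
  have hden : realCn (compModulus k) (ellipticF ψ (compModulus k)) ^ 2 +
      k ^ 2 * Real.sin ψ ^ 2 = 1 - (1 - k ^ 2) * Real.sin ψ ^ 2 := by linarith
  simp only [complexCn, cnNumRe, cnNumIm, cnDen, Complex.add_re, Complex.add_im,
    Complex.ofReal_re, Complex.ofReal_im, Complex.I_mul_re, Complex.I_mul_im, neg_zero, add_zero,
    zero_add, e1, e2, realSn_ellipticF h2, zero_mul, one_mul, one_pow, mul_one, hden,
    Complex.ofReal_zero, zero_sub]
  rw [div_pow, neg_sq, mul_pow, Complex.I_sq]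
  norm_cast
  rw [mul_pow, mul_pow, e3, e4, ← neg_div, div_eq_div_iff (by positivity) hpos.ne']
  push_cast
  ring

lemma charEq_K_add_I_mul_iff {k : ℝ} (hk : k ∈ Set.Ioo (0 : ℝ) 1) {l : ℝ} (ψ : ℝ)
    (hl : l < 1 - k ^ 2) :
    CharEq k l ((ellipticK k : ℂ) + Complex.I * (ellipticF ψ (compModulus k) : ℂ)) ↔
      Real.sin ψ ^ 2 = (1 - 2 * k ^ 2 - l) / ((1 - k ^ 2) * (1 - k ^ 2 - l)) := by
  have h1 := sq_lt_one_of_mem_Ioo hk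
  have hpos := one_sub_sq_mul_sin_sq_pos (compModulus_sq_lt_one hk) ψ
  rw [compModulus_sq h1] at hpos
  rw [charEq_iff_of_sq ((jacobiCn_eq_complexCn hk) ▸ complexCn_K_add_I_mul_sq hk ψ),
    eq_div_iff (mul_pos (by linarith) (by linarith)).ne']
  constructor
  · intro h
    field_simp at h
    linarith
  · intro h
    field_simp
    linarith

/-- At imaginary part $K'$ the formula collapses to $-\mathrm{dn}^2/(k^2\,\mathrm{sn}^2)$ at
$K+F(\varphi,k)$, which the quarter-period shift evaluates. The excluded endpoint $\varphi=\pi/2$ is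
where the resulting expression blows up. -/
lemma complexCn_K_add_I_mul_Kprime_add_sq {k : ℝ} (hk : k ∈ Set.Ioo (0 : ℝ) 1) {φ : ℝ}
    (hφ : φ ∈ Set.Ico 0 (Real.pi / 2)) :
    complexCn k ((ellipticK k : ℂ) + Complex.I * (ellipticK' k : ℂ) + (ellipticF φ k : ℂ)) ^ 2 =
      ((-((1 - k ^ 2) / (k ^ 2 * Real.cos φ ^ 2)) : ℝ) : ℂ) := by
  have h1 := sq_lt_one_of_mem_Ioo hk
  have h2 := compModulus_sq_lt_one hk
  have hk0 : 0 < k := hk.1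
  have hk' := (compModulus_mem_Ioo hk).1
  have hcos : 0 < Real.cos φ :=
    Real.cos_pos_of_mem_Ioo ⟨by linarith [hφ.1, Real.pi_pos], hφ.2⟩
  have hshift := ellipticF_quarter_shift h1 hφ.1 hφ.2
  have e1 : realSn (compModulus k) (ellipticK' k) = 1 := by
    simp [ellipticK', ellipticK, realSn_ellipticF h2]
  have e2 : realCn (compModulus k) (ellipticK' k) = 0 := by
    simp [ellipticK', ellipticK, realCn_ellipticF h2]
  have e3 := realDn_sq h2 (ellipticK' k)
  rw [e1, compModulus_sq h1] at e3
  have e4 := realDn_sq h1 (ellipticK k + ellipticF φ k)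
  have e5 : realSn k (ellipticK k + ellipticF φ k) ^ 2 =
      Real.cos φ ^ 2 / (1 - k ^ 2 * Real.sin φ ^ 2) := by
    rw [← hshift, realSn_ellipticF h1, add_comm, Real.sin_add_pi_div_two, Real.cos_sq_arctan,
      mul_pow, compModulus_sq h1, Real.tan_eq_sin_div_cos]
    have : 1 - k ^ 2 * Real.sin φ ^ 2 = Real.cos φ ^ 2 + (1 - k ^ 2) * Real.sin φ ^ 2 := by
      rw [Real.cos_sq']; ring
    rw [this]
    field_simp
  have hpos := one_sub_sq_mul_sin_sq_pos h1 φ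
  have hs : realSn k (ellipticK k + ellipticF φ k) ^ 2 ≠ 0 := by rw [e5]; positivity
  simp only [complexCn, cnNumRe, cnNumIm, cnDen, Complex.add_re, Complex.add_im,
    Complex.ofReal_re, Complex.ofReal_im, Complex.I_mul_re, Complex.I_mul_im, neg_zero, add_zero,
    zero_add, e1, e2, mul_zero, one_mul, one_pow, mul_one, zero_pow two_ne_zero,
    Complex.ofReal_zero, zero_sub]
  rw [div_pow, neg_sq, mul_pow, Complex.I_sq]
  norm_cast
  rw [mul_pow, mul_pow, mul_pow, e3, e4, e5]
  push_cast
  rw [neg_one_mul, neg_div, neg_inj]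
  rw [e5] at hs
  field_simp
  rw [Real.cos_sq']
  ring

lemma charEq_K_add_I_mul_Kprime_add_iff {k : ℝ} (hk : k ∈ Set.Ioo (0 : ℝ) 1) {l φ : ℝ}
    (hφ : φ ∈ Set.Ico 0 (Real.pi / 2)) (hl : l < 1 - 2 * k ^ 2) :
    CharEq k l ((ellipticK k : ℂ) + Complex.I * (ellipticK' k : ℂ) + (ellipticF φ k : ℂ)) ↔
      Real.sin φ ^ 2 = (-k ^ 2 - l) / (1 - 2 * k ^ 2 - l) := by
  have hk0 : 0 < k := hk.1
  have hcos : 0 < Real.cos φ :=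
    Real.cos_pos_of_mem_Ioo ⟨by linarith [hφ.1, Real.pi_pos], hφ.2⟩
  rw [charEq_iff_of_sq ((jacobiCn_eq_complexCn hk) ▸ complexCn_K_add_I_mul_Kprime_add_sq hk hφ),
    eq_div_iff (by linarith), Real.sin_sq]
  constructor
  · intro h
    field_simp at h
    linarith
  · intro h
    field_simp
    linarith

/-- Here $\mathrm{cn}^2\in[-k'^2/k^2,0]$. Bounds of this kind on each segment confine overlaps
between segments to the band edges. -/
lemma mem_Icc_of_charEq_K_add_I_mul {k : ℝ} (hk : k ∈ Set.Ioo (0 : ℝ) 1) {l ψ : ℝ}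
    (h : CharEq k l ((ellipticK k : ℂ) + Complex.I * (ellipticF ψ (compModulus k) : ℂ))) :
    l ∈ Set.Icc (lam1 k) (lam2 k) := by
  have h1 := sq_lt_one_of_mem_Ioo hk
  have hk0 : 0 < k := hk.1
  have hpos := one_sub_sq_mul_sin_sq_pos (compModulus_sq_lt_one hk) ψ
  rw [compModulus_sq h1] at hpos
  rw [charEq_iff_of_sq ((jacobiCn_eq_complexCn hk) ▸ complexCn_K_add_I_mul_sq hk ψ)] at h
  have hm : 0 < 1 - k ^ 2 := by linarith
  have hr0 : 0 ≤ k ^ 2 * ((1 - k ^ 2) * Real.sin ψ ^ 2 / (1 - (1 - k ^ 2) * Real.sin ψ ^ 2)) := by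
    positivity
  have hr1 : k ^ 2 * ((1 - k ^ 2) * Real.sin ψ ^ 2 / (1 - (1 - k ^ 2) * Real.sin ψ ^ 2)) ≤
      1 - k ^ 2 := by
    rw [← mul_div_assoc, div_le_iff₀ hpos]
    -- With denominators cleared, the right side exceeds the left by $(1-k^2)(1-\sin^2\psi)$.
    nlinarith [mul_nonneg hm.le (sub_nonneg.2 (Real.sin_sq_le_one ψ))]
  rw [lam1, lam2]
  constructor <;> linarith

lemma le_lam1_of_charEq_K_add_I_mul_Kprime_add {k : ℝ} (hk : k ∈ Set.Ioo (0 : ℝ) 1) {l φ : ℝ}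
    (hφ : φ ∈ Set.Ico 0 (Real.pi / 2))
    (h : CharEq k l
      ((ellipticK k : ℂ) + Complex.I * (ellipticK' k : ℂ) + (ellipticF φ k : ℂ))) :
    l ≤ lam1 k := by
  have h1 := sq_lt_one_of_mem_Ioo hk
  have hk0 : 0 < k := hk.1
  have hcos : 0 < Real.cos φ :=
    Real.cos_pos_of_mem_Ioo ⟨by linarith [hφ.1, Real.pi_pos], hφ.2⟩
  rw [charEq_iff_of_sq ((jacobiCn_eq_complexCn hk) ▸ complexCn_K_add_I_mul_Kprime_add_sq hk hφ)] at h
  have hr : 1 - k ^ 2 ≤ k ^ 2 * ((1 - k ^ 2) / (k ^ 2 * Real.cos φ ^ 2)) := by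
    have e : k ^ 2 * ((1 - k ^ 2) / (k ^ 2 * Real.cos φ ^ 2)) = (1 - k ^ 2) / Real.cos φ ^ 2 := by
      field_simp
    rw [e]
    exact le_div_self (by linarith) (by positivity) (Real.cos_sq_le_one φ)
  rw [lam1]
  linarith

lemma mem_Icc_of_charEq_ellipticF {k : ℝ} (hk : k ∈ Set.Ioo (0 : ℝ) 1) {l φ : ℝ}
    (h : CharEq k l (ellipticF φ k : ℂ)) : l ∈ Set.Icc (lam2 k) (lam3 k) := by
  have hk0 : 0 < k := hk.1
  rw [charEq_ellipticF_iff hk, eq_div_iff (by positivity)] at h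
  rw [lam2, lam3]
  constructor <;> nlinarith [Real.sin_sq_le_one φ, mul_nonneg (sq_nonneg (Real.sin φ)) (sq_nonneg k),
    mul_nonneg (sub_nonneg.2 (Real.sin_sq_le_one φ)) (sq_nonneg k)]

/-! ### The amplitudes of the solution -/

/-- The amplitude `φ_α` of the solution on the segment `[0, K]`. -/
noncomputable def phiAlpha (k l : ℝ) : ℝ := Real.arcsin (Real.sqrt (1 - k ^ 2 - l) / k)

/-- The amplitude `φ_β` of the solution on the segment `[K, K + iK']`. -/
noncomputable def phiBeta (k l : ℝ) : ℝ :=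
  Real.arcsin (Real.sqrt (1 - 2 * k ^ 2 - l) / Real.sqrt ((1 - k ^ 2) * (1 - k ^ 2 - l)))

/-- The amplitude `φ_γ` of the solution on the segment `[K + iK', 2K + iK')`. -/
noncomputable def phiGamma (k l : ℝ) : ℝ :=
  Real.arcsin (Real.sqrt (-k ^ 2 - l) / Real.sqrt (1 - 2 * k ^ 2 - l))

lemma arcsin_mem_Icc_of_sq_le_one {r : ℝ} (h0 : 0 ≤ r) (h1 : r ^ 2 ≤ 1) :
    Real.arcsin r ∈ Set.Icc 0 (Real.pi / 2) ∧ Real.sin (Real.arcsin r) = r :=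
  ⟨⟨Real.arcsin_nonneg.2 h0, Real.arcsin_le_pi_div_two r⟩,
    Real.sin_arcsin (by linarith) ((sq_le_one_iff₀ h0).1 h1)⟩

lemma lt_of_sin_sq_lt_sin_sq {φ ψ : ℝ} (hφ : φ ∈ Set.Icc 0 (Real.pi / 2))
    (hψ : ψ ∈ Set.Icc 0 (Real.pi / 2)) (h : Real.sin φ ^ 2 < Real.sin ψ ^ 2) : φ < ψ := by
  by_contra! hle
  have h0 : 0 ≤ Real.sin ψ := Real.sin_nonneg_of_mem_Icc ⟨hψ.1, by linarith [hψ.2, Real.pi_pos]⟩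
  have h1 : Real.sin ψ ≤ Real.sin φ :=
    Real.sin_le_sin_of_le_of_le_pi_div_two (by linarith [hψ.1, Real.pi_pos]) hφ.2 hle
  exact h.not_ge (pow_le_pow_left₀ h0 h1 2)

lemma eq_of_sin_sq_eq_sin_sq {φ ψ : ℝ} (hφ : φ ∈ Set.Icc 0 (Real.pi / 2))
    (hψ : ψ ∈ Set.Icc 0 (Real.pi / 2)) (h : Real.sin φ ^ 2 = Real.sin ψ ^ 2) : φ = ψ := by
  have h0 : 0 ≤ Real.sin ψ := Real.sin_nonneg_of_mem_Icc ⟨hψ.1, by linarith [hψ.2, Real.pi_pos]⟩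
  have h1 : 0 ≤ Real.sin φ := Real.sin_nonneg_of_mem_Icc ⟨hφ.1, by linarith [hφ.2, Real.pi_pos]⟩
  exact Real.injOn_sin ⟨by linarith [hφ.1, Real.pi_pos], hφ.2⟩
    ⟨by linarith [hψ.1, Real.pi_pos], hψ.2⟩ ((sq_eq_sq₀ h1 h0).1 h)

lemma phiAlpha_spec {k l : ℝ} (hk : k ∈ Set.Ioo (0 : ℝ) 1)
    (hl : l ∈ Set.Icc (lam2 k) (lam3 k)) :
    phiAlpha k l ∈ Set.Icc 0 (Real.pi / 2) ∧
      Real.sin (phiAlpha k l) = Real.sqrt (1 - k ^ 2 - l) / k ∧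
      Real.sin (phiAlpha k l) ^ 2 = (1 - k ^ 2 - l) / k ^ 2 := by
  have hk0 : 0 < k := hk.1
  rw [lam2, lam3] at hl
  have hsq : (Real.sqrt (1 - k ^ 2 - l) / k) ^ 2 = (1 - k ^ 2 - l) / k ^ 2 := by
    rw [div_pow, Real.sq_sqrt (by linarith [hl.2])]
  have h := arcsin_mem_Icc_of_sq_le_one (r := Real.sqrt (1 - k ^ 2 - l) / k) (by positivity)
    (by rw [hsq, div_le_one (by positivity)]; linarith [hl.1])
  exact ⟨h.1, h.2, by rw [← hsq, ← h.2]; rfl⟩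

lemma phiBeta_spec {k l : ℝ} (hk : k ∈ Set.Ioo (0 : ℝ) 1)
    (hl : l ∈ Set.Icc (lam1 k) (lam2 k)) :
    phiBeta k l ∈ Set.Icc 0 (Real.pi / 2) ∧
      Real.sin (phiBeta k l) =
        Real.sqrt (1 - 2 * k ^ 2 - l) / Real.sqrt ((1 - k ^ 2) * (1 - k ^ 2 - l)) ∧
      Real.sin (phiBeta k l) ^ 2 = (1 - 2 * k ^ 2 - l) / ((1 - k ^ 2) * (1 - k ^ 2 - l)) := by
  have hk0 : 0 < k ^ 2 := pow_pos hk.1 2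
  have h1 := sq_lt_one_of_mem_Ioo hk
  rw [lam1, lam2] at hl
  have hden : 0 < (1 - k ^ 2) * (1 - k ^ 2 - l) := mul_pos (by linarith) (by linarith [hl.2])
  have hsq : (Real.sqrt (1 - 2 * k ^ 2 - l) / Real.sqrt ((1 - k ^ 2) * (1 - k ^ 2 - l))) ^ 2 =
      (1 - 2 * k ^ 2 - l) / ((1 - k ^ 2) * (1 - k ^ 2 - l)) := by
    rw [div_pow, Real.sq_sqrt (by linarith [hl.2]), Real.sq_sqrt hden.le]
  have h := arcsin_mem_Icc_of_sq_le_one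
    (r := Real.sqrt (1 - 2 * k ^ 2 - l) / Real.sqrt ((1 - k ^ 2) * (1 - k ^ 2 - l)))
    -- Denominator minus numerator is $k^2(k^2+\lambda)$, nonnegative exactly when
    -- $\lambda\ge\lambda_1$.
    (by positivity) (by rw [hsq, div_le_one hden]; nlinarith [hl.1])
  exact ⟨h.1, h.2, by rw [← hsq, ← h.2]; rfl⟩

lemma phiGamma_spec {k l : ℝ} (hk : k ∈ Set.Ioo (0 : ℝ) 1) (hl : l ∈ Set.Iic (lam1 k)) :
    phiGamma k l ∈ Set.Ico 0 (Real.pi / 2) ∧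
      Real.sin (phiGamma k l) = Real.sqrt (-k ^ 2 - l) / Real.sqrt (1 - 2 * k ^ 2 - l) ∧
      Real.sin (phiGamma k l) ^ 2 = (-k ^ 2 - l) / (1 - 2 * k ^ 2 - l) := by
  have h1 := sq_lt_one_of_mem_Ioo hk
  rw [lam1, Set.mem_Iic] at hl
  have hden : 0 < 1 - 2 * k ^ 2 - l := by linarith
  have hsq : (Real.sqrt (-k ^ 2 - l) / Real.sqrt (1 - 2 * k ^ 2 - l)) ^ 2 =
      (-k ^ 2 - l) / (1 - 2 * k ^ 2 - l) := by
    rw [div_pow, Real.sq_sqrt (by linarith), Real.sq_sqrt hden.le]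
  -- Denominator minus numerator is the constant $1-k^2>0$, so the amplitude stays strictly below
  -- $\pi/2$.
  have hlt : (-k ^ 2 - l) / (1 - 2 * k ^ 2 - l) < 1 := by rw [div_lt_one hden]; linarith
  have h0 : 0 ≤ Real.sqrt (-k ^ 2 - l) / Real.sqrt (1 - 2 * k ^ 2 - l) := by positivity
  have h := arcsin_mem_Icc_of_sq_le_one h0 (by rw [hsq]; exact hlt.le)
  refine ⟨⟨h.1.1, ?_⟩, h.2, by rw [← hsq, ← h.2]; rfl⟩
  exact Real.arcsin_lt_pi_div_two.2 ((sq_lt_one_iff₀ h0).1 (hsq ▸ hlt))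

/-! ### Values at the band edges -/

lemma lam1_lt_lam2 {k : ℝ} (hk : k ∈ Set.Ioo (0 : ℝ) 1) : lam1 k < lam2 k := by
  have h1 := sq_lt_one_of_mem_Ioo hk
  rw [lam1, lam2]; linarith

lemma phiAlpha_lam3 (k : ℝ) : phiAlpha k (lam3 k) = 0 := by simp [phiAlpha, lam3]

lemma phiAlpha_lam2 {k : ℝ} (hk : k ∈ Set.Ioo (0 : ℝ) 1) : phiAlpha k (lam2 k) = Real.pi / 2 := by
  have hk0 : 0 < k := hk.1
  have h : 1 - k ^ 2 - lam2 k = k ^ 2 := by rw [lam2]; ring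
  rw [phiAlpha, h, Real.sqrt_sq hk0.le, div_self hk0.ne', Real.arcsin_one]

lemma phiBeta_lam2 (k : ℝ) : phiBeta k (lam2 k) = 0 := by simp [phiBeta, lam2]

lemma phiBeta_lam1 {k : ℝ} (hk : k ∈ Set.Ioo (0 : ℝ) 1) : phiBeta k (lam1 k) = Real.pi / 2 := by
  have h1 := sq_lt_one_of_mem_Ioo hk
  have e1 : 1 - 2 * k ^ 2 - lam1 k = 1 - k ^ 2 := by rw [lam1]; ring
  have e2 : (1 - k ^ 2) * (1 - k ^ 2 - lam1 k) = 1 - k ^ 2 := by rw [lam1]; ring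
  rw [phiBeta, e1, e2, div_self (Real.sqrt_pos.2 (by linarith)).ne', Real.arcsin_one]

lemma phiGamma_lam1 (k : ℝ) : phiGamma k (lam1 k) = 0 := by simp [phiGamma, lam1]

/-! ### Monotonicity -/

lemma strictAntiOn_ellipticF_phiAlpha {k : ℝ} (hk : k ∈ Set.Ioo (0 : ℝ) 1) :
    StrictAntiOn (fun l => ellipticF (phiAlpha k l) k) (Set.Icc (lam2 k) (lam3 k)) := by
  intro l hl l' hl' hlt
  obtain ⟨m, -, e⟩ := phiAlpha_spec hk hl
  obtain ⟨m', -, e'⟩ := phiAlpha_spec hk hl'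
  refine strictMono_ellipticF (sq_lt_one_of_mem_Ioo hk) (lt_of_sin_sq_lt_sin_sq m' m ?_)
  rw [e, e']
  exact div_lt_div_of_pos_right (by linarith) (pow_pos hk.1 2)

lemma strictAntiOn_ellipticF_phiBeta {k : ℝ} (hk : k ∈ Set.Ioo (0 : ℝ) 1) :
    StrictAntiOn (fun l => ellipticF (phiBeta k l) (compModulus k))
      (Set.Icc (lam1 k) (lam2 k)) := by
  intro l hl l' hl' hlt
  obtain ⟨m, -, e⟩ := phiBeta_spec hk hl
  obtain ⟨m', -, e'⟩ := phiBeta_spec hk hl'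
  refine strictMono_ellipticF (compModulus_sq_lt_one hk) (lt_of_sin_sq_lt_sin_sq m' m ?_)
  have hk0 : 0 < k ^ 2 := pow_pos hk.1 2
  have h1 := sq_lt_one_of_mem_Ioo hk
  have hm : 0 < 1 - k ^ 2 := by linarith
  rw [lam1, lam2] at hl hl'
  rw [e, e', div_lt_div_iff₀ (mul_pos hm (by linarith [hl'.2])) (mul_pos hm (by linarith [hl.2]))]
  -- The cross-multiplied sides differ by exactly $k^2(1-k^2)(\lambda'-\lambda)$.
  nlinarith [mul_pos (mul_pos hm hk0) (sub_pos.2 hlt)]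

lemma strictAntiOn_ellipticF_phiGamma {k : ℝ} (hk : k ∈ Set.Ioo (0 : ℝ) 1) :
    StrictAntiOn (fun l => ellipticF (phiGamma k l) k) (Set.Iic (lam1 k)) := by
  intro l hl l' hl' hlt
  obtain ⟨m, -, e⟩ := phiGamma_spec hk hl
  obtain ⟨m', -, e'⟩ := phiGamma_spec hk hl'
  have h1 := sq_lt_one_of_mem_Ioo hk
  refine strictMono_ellipticF h1
    (lt_of_sin_sq_lt_sin_sq ⟨m'.1, m'.2.le⟩ ⟨m.1, m.2.le⟩ ?_)
  have hm : 0 < 1 - k ^ 2 := by linarith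
  rw [lam1, Set.mem_Iic] at hl hl'
  rw [e, e', div_lt_div_iff₀ (by linarith) (by linarith)]
  nlinarith [mul_pos hm (sub_pos.2 hlt)]

lemma tendsto_ellipticF_phiGamma {k : ℝ} (hk : k ∈ Set.Ioo (0 : ℝ) 1) :
    Filter.Tendsto (fun l => ellipticF (phiGamma k l) k) Filter.atBot (nhds (ellipticK k)) := by
  have h1 := sq_lt_one_of_mem_Ioo hk
  have hden : Filter.Tendsto (fun l : ℝ => 1 - 2 * k ^ 2 - l) Filter.atBot Filter.atTop :=
    Filter.tendsto_atTop_add_const_left _ _ Filter.tendsto_neg_atBot_atTop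
  -- This is $\sin\varphi_\gamma$ rewritten so that its limit 1 is visible; the two forms agree for
  -- $\lambda\le\lambda_1$.
  have hr : Filter.Tendsto (fun l : ℝ => Real.sqrt (1 - (1 - k ^ 2) / (1 - 2 * k ^ 2 - l)))
      Filter.atBot (nhds 1) := by
    simpa using ((hden.const_div_atTop (1 - k ^ 2)).const_sub 1).sqrt
  have hphi : Filter.Tendsto (phiGamma k) Filter.atBot (nhds (Real.pi / 2)) := by
    rw [← Real.arcsin_one]
    refine ((Real.continuous_arcsin.tendsto 1).comp hr).congr' ?_
    filter_upwards [Filter.eventually_le_atBot (lam1 k)] with l hl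
    rw [lam1] at hl
    have hpos : 0 < 1 - 2 * k ^ 2 - l := by linarith
    rw [Function.comp_apply, phiGamma, ← Real.sqrt_div' _ hpos.le]
    congr 2
    rw [eq_div_iff hpos.ne', sub_mul, div_mul_cancel₀ _ hpos.ne']
    ring
  exact ((continuous_ellipticF h1).tendsto _).comp hphi

/-! ### Solutions of the characteristic equation on the path -/

/-- A point of the path solving the characteristic equation is the solution described on one of
the three segments. -/
lemma charEq_cases {k l : ℝ} (hk : k ∈ Set.Ioo (0 : ℝ) 1) {a : ℂ} (ha : a ∈ alphaPath k)
    (h : CharEq k l a) :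
    (l ∈ Set.Icc (lam2 k) (lam3 k) ∧ a = (ellipticF (phiAlpha k l) k : ℂ)) ∨
    (l ∈ Set.Icc (lam1 k) (lam2 k) ∧
      a = (ellipticK k : ℂ) + Complex.I * (ellipticF (phiBeta k l) (compModulus k) : ℂ)) ∨
    (l ∈ Set.Iic (lam1 k) ∧
      a = (ellipticK k : ℂ) + Complex.I * (ellipticK' k : ℂ) +
        (ellipticF (phiGamma k l) k : ℂ)) := by
  have hk0 : 0 < k ^ 2 := pow_pos hk.1 2
  have h1 := sq_lt_one_of_mem_Ioo hk
  have h2 := compModulus_sq_lt_one hk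
  rcases ha with ⟨x, hx, rfl⟩ | ⟨β, hβ, rfl⟩ | ⟨γ, hγ, rfl⟩
  · obtain ⟨φ, hφ, rfl⟩ := exists_ellipticF_eq_of_mem_Icc h1 hx
    have hl := mem_Icc_of_charEq_ellipticF hk h
    obtain ⟨m, -, e⟩ := phiAlpha_spec hk hl
    rw [charEq_ellipticF_iff hk] at h
    exact Or.inl ⟨hl, by rw [eq_of_sin_sq_eq_sin_sq hφ m (h.trans e.symm)]⟩
  · obtain ⟨ψ, hψ, rfl⟩ := exists_ellipticF_eq_of_mem_Icc h2 hβ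
    have hl := mem_Icc_of_charEq_K_add_I_mul hk h
    obtain ⟨m, -, e⟩ := phiBeta_spec hk hl
    rw [charEq_K_add_I_mul_iff hk ψ (by have := hl.2; rw [lam2] at this; linarith)] at h
    exact Or.inr (Or.inl ⟨hl, by rw [eq_of_sin_sq_eq_sin_sq hψ m (h.trans e.symm)]⟩)
  · obtain ⟨φ, hφ, rfl⟩ := exists_ellipticF_eq_of_mem_Ico h1 hγ
    have hl := le_lam1_of_charEq_K_add_I_mul_Kprime_add hk hφ h
    obtain ⟨m, -, e⟩ := phiGamma_spec hk hl
    rw [charEq_K_add_I_mul_Kprime_add_iff hk hφ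
      (by have := hl; rw [lam1] at this; linarith)] at h
    refine Or.inr (Or.inr ⟨hl, ?_⟩)
    rw [eq_of_sin_sq_eq_sin_sq ⟨hφ.1, hφ.2.le⟩ ⟨m.1, m.2.le⟩ (h.trans e.symm)]

lemma charEq_phiAlpha {k l : ℝ} (hk : k ∈ Set.Ioo (0 : ℝ) 1)
    (hl : l ∈ Set.Icc (lam2 k) (lam3 k)) : CharEq k l (ellipticF (phiAlpha k l) k : ℂ) :=
  (charEq_ellipticF_iff hk _ _).2 (phiAlpha_spec hk hl).2.2

lemma charEq_phiBeta {k l : ℝ} (hk : k ∈ Set.Ioo (0 : ℝ) 1)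
    (hl : l ∈ Set.Icc (lam1 k) (lam2 k)) :
    CharEq k l
      ((ellipticK k : ℂ) + Complex.I * (ellipticF (phiBeta k l) (compModulus k) : ℂ)) := by
  refine (charEq_K_add_I_mul_iff hk _ ?_).2 (phiBeta_spec hk hl).2.2
  have := hl.2
  rw [lam2] at this
  linarith [pow_pos hk.1 2]

lemma charEq_phiGamma {k l : ℝ} (hk : k ∈ Set.Ioo (0 : ℝ) 1) (hl : l ∈ Set.Iic (lam1 k)) :
    CharEq k l ((ellipticK k : ℂ) + Complex.I * (ellipticK' k : ℂ) +
      (ellipticF (phiGamma k l) k : ℂ)) := by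
  refine (charEq_K_add_I_mul_Kprime_add_iff hk (phiGamma_spec hk hl).1 ?_).2 (phiGamma_spec hk hl).2.2
  exact lt_of_le_of_lt hl (lam1_lt_lam2 hk)

/-- Both sides are the corner $K$ of the path. This reconciles the first two cases at their shared
band edge. -/
lemma solution_lam2 {k : ℝ} (hk : k ∈ Set.Ioo (0 : ℝ) 1) :
    (ellipticF (phiAlpha k (lam2 k)) k : ℂ) =
      (ellipticK k : ℂ) + Complex.I * (ellipticF (phiBeta k (lam2 k)) (compModulus k) : ℂ) := by
  simp [phiAlpha_lam2 hk, phiBeta_lam2, ellipticK]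

lemma solution_lam1 {k : ℝ} (hk : k ∈ Set.Ioo (0 : ℝ) 1) :
    (ellipticK k : ℂ) + Complex.I * (ellipticF (phiBeta k (lam1 k)) (compModulus k) : ℂ) =
      (ellipticK k : ℂ) + Complex.I * (ellipticK' k : ℂ) +
        (ellipticF (phiGamma k (lam1 k)) k : ℂ) := by
  simp [phiBeta_lam1 hk, phiGamma_lam1, ellipticK', ellipticK]

theorem proposition3p1 (k : ℝ) (hk : k ∈ Set.Ioo (0 : ℝ) 1) :
    -- the function `cn(·, k)` of a complex argument is well defined
    (∃! f : ℂ → ℂ, IsJacobiCn k f) ∧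
    ∃ φα φβ φγ : ℝ → ℝ,
      -- `l ∈ [λ₂, λ₃]`: `α = F(φα, k) ∈ [0, K]`
      (∀ l ∈ Set.Icc (lam2 k) (lam3 k),
        φα l ∈ Set.Icc 0 (Real.pi / 2) ∧
        Real.sin (φα l) = Real.sqrt (1 - k ^ 2 - l) / k ∧
        ellipticF (φα l) k ∈ Set.Icc 0 (ellipticK k) ∧
        ∀ a ∈ alphaPath k, CharEq k l a ↔ a = (ellipticF (φα l) k : ℂ)) ∧
      -- `l ∈ [λ₁, λ₂]`: `α = K + iβ` with `β = F(φβ, k') ∈ [0, K']`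
      (∀ l ∈ Set.Icc (lam1 k) (lam2 k),
        φβ l ∈ Set.Icc 0 (Real.pi / 2) ∧
        Real.sin (φβ l) =
          Real.sqrt (1 - 2 * k ^ 2 - l) / Real.sqrt ((1 - k ^ 2) * (1 - k ^ 2 - l)) ∧
        ellipticF (φβ l) (compModulus k) ∈ Set.Icc 0 (ellipticK' k) ∧
        ∀ a ∈ alphaPath k, CharEq k l a ↔
          a = (ellipticK k : ℂ) + Complex.I * (ellipticF (φβ l) (compModulus k) : ℂ)) ∧
      -- `l ∈ (-∞, λ₁]`: `α = K + iK' + γ` with `γ = F(φγ, k) ∈ [0, K)`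
      (∀ l ∈ Set.Iic (lam1 k),
        φγ l ∈ Set.Ico 0 (Real.pi / 2) ∧
        Real.sin (φγ l) = Real.sqrt (-k ^ 2 - l) / Real.sqrt (1 - 2 * k ^ 2 - l) ∧
        ellipticF (φγ l) k ∈ Set.Ico 0 (ellipticK k) ∧
        ∀ a ∈ alphaPath k, CharEq k l a ↔
          a = (ellipticK k : ℂ) + Complex.I * (ellipticK' k : ℂ) + (ellipticF (φγ l) k : ℂ)) ∧
      -- as `l` decreases from `λ₃` to `-∞`, `α` runs monotonically through the three segments
      (StrictAntiOn (fun l => ellipticF (φα l) k) (Set.Icc (lam2 k) (lam3 k)) ∧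
        ellipticF (φα (lam3 k)) k = 0 ∧ ellipticF (φα (lam2 k)) k = ellipticK k) ∧
      (StrictAntiOn (fun l => ellipticF (φβ l) (compModulus k)) (Set.Icc (lam1 k) (lam2 k)) ∧
        ellipticF (φβ (lam2 k)) (compModulus k) = 0 ∧
        ellipticF (φβ (lam1 k)) (compModulus k) = ellipticK' k) ∧
      (StrictAntiOn (fun l => ellipticF (φγ l) k) (Set.Iic (lam1 k)) ∧
        ellipticF (φγ (lam1 k)) k = 0 ∧
        Filter.Tendsto (fun l => ellipticF (φγ l) k) Filter.atBot (nhds (ellipticK k))) := by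
  have h1 := sq_lt_one_of_mem_Ioo hk
  have h2 := compModulus_sq_lt_one hk
  have h12 := lam1_lt_lam2 hk
  refine ⟨existsUnique_isJacobiCn hk, phiAlpha k, phiBeta k, phiGamma k, ?_, ?_, ?_,
    ⟨strictAntiOn_ellipticF_phiAlpha hk, by rw [phiAlpha_lam3, ellipticF_zero],
      by rw [phiAlpha_lam2 hk, ellipticK]⟩,
    ⟨strictAntiOn_ellipticF_phiBeta hk, by rw [phiBeta_lam2, ellipticF_zero],
      by rw [phiBeta_lam1 hk, ellipticK', ellipticK]⟩,
    ⟨strictAntiOn_ellipticF_phiGamma hk, by rw [phiGamma_lam1, ellipticF_zero],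
      tendsto_ellipticF_phiGamma hk⟩⟩
  · intro l hl
    obtain ⟨m, e, -⟩ := phiAlpha_spec hk hl
    refine ⟨m, e, ellipticF_mem_Icc h1 m, fun a ha => ⟨fun h => ?_, ?_⟩⟩
    · rcases charEq_cases hk ha h with ⟨-, rfl⟩ | ⟨hl', rfl⟩ | ⟨hl', rfl⟩
      · rfl
      -- A solution on the adjacent segment forces $\lambda$ to be the shared band edge; one on the
      -- remaining segment would contradict $\lambda_1<\lambda_2$.
      · obtain rfl : l = lam2 k := le_antisymm hl'.2 hl.1
        exact (solution_lam2 hk).symm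
      · exact absurd (hl.1.trans hl') h12.not_ge
    · rintro rfl
      exact charEq_phiAlpha hk hl
  · intro l hl
    obtain ⟨m, e, -⟩ := phiBeta_spec hk hl
    refine ⟨m, e, ellipticF_mem_Icc h2 m, fun a ha => ⟨fun h => ?_, ?_⟩⟩
    · rcases charEq_cases hk ha h with ⟨hl', rfl⟩ | ⟨-, rfl⟩ | ⟨hl', rfl⟩
      · obtain rfl : l = lam2 k := le_antisymm hl.2 hl'.1
        exact solution_lam2 hk
      · rfl
      · obtain rfl : l = lam1 k := le_antisymm hl' hl.1
        exact (solution_lam1 hk).symm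
    · rintro rfl
      exact charEq_phiBeta hk hl
  · intro l hl
    obtain ⟨m, e, -⟩ := phiGamma_spec hk hl
    refine ⟨m, e, ellipticF_mem_Ico h1 m, fun a ha => ⟨fun h => ?_, ?_⟩⟩
    · rcases charEq_cases hk ha h with ⟨hl', rfl⟩ | ⟨hl', rfl⟩ | ⟨-, rfl⟩
      · exact absurd (hl'.1.trans hl) h12.not_ge
      · obtain rfl : l = lam1 k := le_antisymm hl hl'.1
        exact solution_lam1 hk
      · rfl
    · rintro rfl
      exact charEq_phiGamma hk hl
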